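/- Let $\tau$ be a finite vocabulary (predicate, function and constant symbols); all structures have non-empty universes. A theory $T(\bar x)$ with free variables $\bar x=(x_1,\dots,x_n)$, $n\ge 0$, is a set of first-order $\tau$-formulas whose free variables are among $\bar x$. Let $T'$ be the theory obtained from $T(\bar x)$ by replacing each $x_i$ with a fresh constant symbol $c_i$. Two theories with free variables $\bar x$ are equivalent if in every $\tau$-structure they are satisfied by the same $n$-tuples. For $k\in\mathbb N$, a structure $M$ is a $k$-ary covered extension of a non-empty collection $R$ of substructures of $M$ if every set of at most $k$ elements of $M$ is contained in some member of $R$. It is a finitary covered extension of a collection $R$ of substructures of $M$ if every finite set of elements of $M$ is contained in some member of $R$. Say that $T(\bar x)\in PCE(k)$ (respectively, $T(\bar x)\in PCE_f$) if, whenever $M$ is a $k$-ary (respectively, finitary) covered extension of a collection $R$ of models of $T'$, the structure $M$ is a model of $T'$. A $\forall^k\exists^*$ formula is a prenex formula whose quantifier prefix consists of exactly $k$ universal quantifiers followed by finitely many (possibly zero) existential quantifiers. A $\Pi^0_2$ formula is a $\forall^k\exists^*$ formula for some $k\ge 0$. Theorem. Let $T(\bar x)$ be a theory with free variables $\bar x$.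 (1) $T(\bar x)\in PCE_f$ if and only if $T(\bar x)$ is equivalent to a theory of $\Pi^0_2$ formulas with free variables $\bar x$. (2) For every $k\in\mathbb N$, $T(\bar x)\in PCE(k)$ if and only if $T(\bar x)$ is equivalent to a theory of $\forall^k\exists^*$ formulas with free variables $\bar x$. In particular (the case $k=0$, the extensional Łoś–Tarski theorem for theories): every extension of every model of $T'$ is a model of $T'$ if and only if $T(\bar x)$ is equivalent to a theory of existential formulas (prenex, with only existential quantifiers) with free variables $\bar x$. -/

import Mathlib

open FirstOrder

universe u v w

namespace CoveredExtensions

open FirstOrder.Language (Formula)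

/-- `φ` is a prenex formula `∀ ⋯ ∀ ∃ ⋯ ∃ ψ` with `ψ` quantifier-free, a leading block of exactly `k`
universal quantifiers, and any number (possibly zero) of existential quantifiers. -/
inductive IsForallExists {L : FirstOrder.Language.{u, v}} {α : Type} :
    ℕ → ∀ {n : ℕ}, L.BoundedFormula α n → Prop
  | of_isExistential {n : ℕ} {φ : L.BoundedFormula α n} (h : φ.IsExistential) :
      IsForallExists 0 φ
  | all {k n : ℕ} {φ : L.BoundedFormula α (n + 1)} (h : IsForallExists k φ) :
      IsForallExists (k + 1) φ.all

/-- `φ` is a `Π⁰₂` formula: prenex, with quantifier prefix of the form `∀*∃*`. -/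
def IsPiTwo {L : FirstOrder.Language.{u, v}} {α : Type} (φ : L.Formula α) : Prop :=
  ∃ k : ℕ, IsForallExists k φ

/-- A set `R` of substructures of `M`, each with nonempty universe, is a `k`-ary cover of `M`
(that is, `M` is a `k`-ary covered extension of `R`). -/
structure IsKAryCover {L : FirstOrder.Language.{u, v}} {M : Type w} [L.Structure M] (k : ℕ)
    (R : Set (L.Substructure M)) : Prop where
  nonempty : R.Nonempty
  nonempty_of_mem : ∀ N ∈ R, Nonempty N
  covers : ∀ A : Finset M, A.card ≤ k → ∃ N ∈ R, (A : Set M) ⊆ N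

/-- A set `R` of substructures of `M`, each with nonempty universe, is a finitary cover of `M`
(that is, `M` is a finitary covered extension of `R`). -/
structure IsFinitaryCover {L : FirstOrder.Language.{u, v}} {M : Type w} [L.Structure M]
    (R : Set (L.Substructure M)) : Prop where
  nonempty_of_mem : ∀ N ∈ R, Nonempty N
  covers : ∀ A : Finset M, ∃ N ∈ R, (A : Set M) ⊆ N

/-- The class `S` of structures is preserved under `k`-ary covered extensions. -/
def PreservedKAry {L : FirstOrder.Language.{u, v}} (k : ℕ)
    (S : Set (CategoryTheory.Bundled.{w} L.Structure)) : Prop :=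
  ∀ (M : CategoryTheory.Bundled.{w} L.Structure) (R : Set (L.Substructure M)),
    (∀ N ∈ R, CategoryTheory.Bundled.of (c := L.Structure) N ∈ S) → IsKAryCover k R → M ∈ S

/-- The class `S` of structures is preserved under finitary covered extensions. -/
def PreservedFinitary {L : FirstOrder.Language.{u, v}}
    (S : Set (CategoryTheory.Bundled.{w} L.Structure)) : Prop :=
  ∀ (M : CategoryTheory.Bundled.{w} L.Structure) (R : Set (L.Substructure M)),
    (∀ N ∈ R, CategoryTheory.Bundled.of (c := L.Structure) N ∈ S) → IsFinitaryCover R → M ∈ S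

/-- The class `S` of structures is preserved under extensions. -/
def PreservedExtensions {L : FirstOrder.Language.{u, v}}
    (S : Set (CategoryTheory.Bundled.{w} L.Structure)) : Prop :=
  ∀ (M : CategoryTheory.Bundled.{w} L.Structure) (N : L.Substructure M),
    Nonempty N → CategoryTheory.Bundled.of (c := L.Structure) N ∈ S → M ∈ S

/-- The class of models of a theory; as usual, structures have nonempty universes. -/
def modelClass {L : FirstOrder.Language.{u, v}} (T : L.Theory) :
    Set (CategoryTheory.Bundled.{w} L.Structure) :=
  {M | Nonempty M ∧ M ⊨ T}

/-- The theory obtained from a theory `T` with free variables `x₁, …, xₙ` by replacing each `xᵢ`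
with a fresh constant symbol `cᵢ`. -/
def closeTheory {L : FirstOrder.Language.{u, v}} {n : ℕ} (T : Set (L.Formula (Fin n))) :
    (L[[Fin n]]).Theory :=
  Formula.equivSentence '' T

/-- The theory `T` with free variables `x₁, …, xₙ` is in `PCE(k)`. -/
def MemPCE {L : FirstOrder.Language.{u, v}} {n : ℕ} (k : ℕ) (T : Set (L.Formula (Fin n))) : Prop :=
  PreservedKAry k (modelClass.{u, v, w} (closeTheory T))

/-- The theory `T` with free variables `x₁, …, xₙ` is in `PCE_f`. -/
def MemPCEf {L : FirstOrder.Language.{u, v}} {n : ℕ} (T : Set (L.Formula (Fin n))) : Prop :=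
  PreservedFinitary (modelClass.{u, v, w} (closeTheory T))

/-- The theory `T` with free variables `x₁, …, xₙ` is preserved under extensions. -/
def MemPE {L : FirstOrder.Language.{u, v}} {n : ℕ} (T : Set (L.Formula (Fin n))) : Prop :=
  PreservedExtensions (modelClass.{u, v, w} (closeTheory T))

/-- Two theories with free variables `x₁, …, xₙ` are equivalent: in every structure they are
satisfied by the same tuples. -/
def TheoryEquiv {L : FirstOrder.Language.{u, v}} {n : ℕ} (T Γ : Set (L.Formula (Fin n))) : Prop :=
  ∀ (M : Type w) [L.Structure M] [Nonempty M] (a : Fin n → M),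
    (∀ φ ∈ T, φ.Realize a) ↔ ∀ φ ∈ Γ, φ.Realize a

end CoveredExtensions

/-!
Call a formula `∀ᵏ∃*` if it is prenex with `k` universal quantifiers followed by existential ones.

One direction is direct: an existential formula passes from a substructure to the whole structure,
so a `∀ᵏ∃*` formula holds in `M` as soon as any `k` elements of `M` lie in a substructure in which
it holds (`IsForallExists.realize_of_covers`).

Conversely, let `T` be preserved, and let all `∀ᵏ∃*` consequences of `T` hold in `(M, a)`; the claim
is that `T` holds in `(M, a)`, so that `T` is axiomatized by these consequences. Let `M*` be the
ultrapower of `M` over a nonprincipal ultrafilter on `ℕ`, and let `b` be a `k`-tuple of `M*`.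

* By compactness there is a countable model `N` of `T` with a tuple `(a', b')` all of whose
  existential properties are shared by `(a, b)` in `M*`. Otherwise `T` would imply
  `∀ y, σ₁(x, y) ∨ ⋯ ∨ σᵣ(x, y)` for existential formulas `σᵢ` false at `(a, b)`, and this is
  equivalent to a `∀ᵏ∃*` consequence of `T` failing in `M*`
  (`exists_countable_model_of_consequences`).
* The vocabulary being countable, `M*` is `ℵ₁`-saturated, so `N` embeds into `M*` with `(a', b')`
  going to `(a, b)` (`exists_embedding_ultrapower`).

The images of these models form a `k`-ary cover of `M*`, so `T` holds in `M*`, and hence in `M` by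
Łoś's theorem. The finitary case uses all `k` at once, and preservation under extensions is the case
`k = 0`.
-/

namespace CoveredExtensions

open FirstOrder.Language FirstOrder.Language.BoundedFormula Filter

universe w'

/-! ### Syntax: existential closures and blocks of universal quantifiers -/

section Quantifiers

variable {L : FirstOrder.Language.{u, v}} {α : Type} {M : Type w} [L.Structure M]

theorem isExistential_exs {n : ℕ} {φ : L.BoundedFormula α n} (h : φ.IsExistential) :
    φ.exs.IsExistential := by
  induction n with
  | zero => exact h
  | succ n ih => exact ih h.ex

theorem isExistential_relabel {β : Type} {m n : ℕ} {φ : L.BoundedFormula α m}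
    (h : φ.IsExistential) (g : α → β ⊕ Fin n) : (φ.relabel g).IsExistential := by
  induction h with
  | of_isQF h => exact (h.relabel g).isExistential
  | ex _ ih => rw [relabel_ex]; exact ih.ex

theorem isForallExists_alls {j k : ℕ} {φ : L.BoundedFormula α k} (h : IsForallExists j φ) :
    IsForallExists (j + k) φ.alls := by
  induction k generalizing j with
  | zero => exact h
  | succ k ih =>
    have := ih h.all
    rwa [add_right_comm] at this

theorem isForallExists_zero_iff {n : ℕ} {φ : L.BoundedFormula α n} :
    IsForallExists 0 φ ↔ φ.IsExistential := by
  refine ⟨fun h => ?_, .of_isExistential⟩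
  cases h with
  | of_isExistential h => exact h

/-- The formula `∀ y₁ ⋯ yₖ, φ`, where the variables `y` are the right summand. Unlike
`Formula.iAlls`, the number of quantifiers is `k` by construction. -/
def forallBlock {k : ℕ} (φ : L.Formula (α ⊕ Fin k)) : L.Formula α :=
  (BoundedFormula.relabel id φ : L.BoundedFormula α k).alls

theorem isForallExists_forallBlock {k : ℕ} {φ : L.Formula (α ⊕ Fin k)} (h : φ.IsExistential) :
    IsForallExists k (forallBlock φ) := by
  have := isForallExists_alls (IsForallExists.of_isExistential (isExistential_relabel h
    (id : α ⊕ Fin k → α ⊕ Fin k)))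
  rwa [zero_add] at this

theorem realize_forallBlock {k : ℕ} {φ : L.Formula (α ⊕ Fin k)} {a : α → M} :
    (forallBlock φ).Realize a ↔ ∀ b : Fin k → M, φ.Realize (Sum.elim a b) := by
  rw [forallBlock, realize_alls]
  refine forall_congr' fun b => ?_
  rw [BoundedFormula.realize_relabel, Formula.Realize, iff_iff_eq]
  congr 1
  exact Subsingleton.elim _ _

theorem realize_congr_of_eqOn_freeVarFinset [DecidableEq α] {φ : L.Formula α} {a b : α → M}
    (h : ∀ i ∈ φ.freeVarFinset, a i = b i) : φ.Realize a ↔ φ.Realize b := by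
  rw [Formula.Realize, Formula.Realize,
    ← realize_restrictFreeVar (f := id) (v := fun i : φ.freeVarFinset => a i) a fun _ => rfl,
    ← realize_restrictFreeVar (f := id) (v := fun i : φ.freeVarFinset => a i) b
      fun i => h i i.2]

open Classical in
/-- The existential closure `∃ z₀ z₁ ⋯, σ` of a formula over all variables of the right summand.
Only the finitely many variables `z₀, …, zₘ` with `m` the largest index occurring in `σ` are really
quantified. Drawing all existential variables from one infinite supply makes these closures commute
with disjunctions. -/
noncomputable def existsNat (σ : L.Formula (α ⊕ ℕ)) : L.Formula α :=
  (σ.relabel (Sum.map id (Fin.ofNat (σ.freeVarFinset.sup (Sum.elim 0 id) + 1)))).iExs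
    (Fin (σ.freeVarFinset.sup (Sum.elim 0 id) + 1))

theorem isExistential_existsNat {σ : L.Formula (α ⊕ ℕ)} (h : σ.IsQF) :
    (existsNat σ).IsExistential :=
  isExistential_exs ((h.relabel _).relabel _).isExistential

theorem realize_existsNat {σ : L.Formula (α ⊕ ℕ)} {a : α → M} :
    (existsNat σ).Realize a ↔ ∃ z : ℕ → M, σ.Realize (Sum.elim a z) := by
  classical
  rw [existsNat, Formula.realize_iExs]
  constructor
  · rintro ⟨z, hz⟩
    rw [Formula.realize_relabel, Sum.elim_comp_map, Function.comp_id] at hz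
    exact ⟨_, hz⟩
  · rintro ⟨z, hz⟩
    refine ⟨fun i => z i, ?_⟩
    rw [Formula.realize_relabel, Sum.elim_comp_map, Function.comp_id]
    refine (realize_congr_of_eqOn_freeVarFinset ?_).1 hz
    rintro (i | i) hi
    · rfl
    · have : i ≤ σ.freeVarFinset.sup (Sum.elim 0 id) :=
        Finset.le_sup (f := Sum.elim (0 : α → ℕ) id) hi
      simp only [Sum.elim_inr, Function.comp_apply, Fin.val_ofNat]
      rw [Nat.mod_eq_of_lt (by convert Nat.lt_succ_of_le this)]

end Quantifiers

/-! ### Compactness for sets of formulas, with countable models -/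

section Compactness

variable {L : FirstOrder.Language.{u, v}}

theorem exists_countable_model [Countable L.Symbols] {T : L.Theory} (hT : T.IsSatisfiable) :
    ∃ (N : Type (max u v)) (_ : L.Structure N), Nonempty N ∧ Countable N ∧ N ⊨ T := by
  obtain ⟨M⟩ := hT
  have : Countable (Σ n, (L.sum L.skolem₁).Functions n) := by
    rw [← Cardinal.mk_le_aleph0_iff]
    refine card_functions_sum_skolem₁_le.trans (max_le le_rfl ?_)
    exact Cardinal.mk_le_aleph0_iff.2 ‹_›
  -- the Skolem hull of the empty set
  let S := (Substructure.closure (L.sum L.skolem₁) (∅ : Set M)).elementarySkolem₁Reduct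
  have hS : Countable S := Set.countable_empty.substructure_closure (L.sum L.skolem₁)
  exact ⟨S, inferInstance, inferInstance, hS, inferInstance⟩

/-- A set of formulas each of whose finite subsets is realized by some tuple in some structure is
realized in a countable structure. -/
theorem exists_countable_realize [Countable L.Symbols] {α : Type} [Countable α]
    {S : Set (L.Formula α)}
    (h : ∀ s : Finset (L.Formula α), (s : Set (L.Formula α)) ⊆ S →
      ∃ (M : Type w) (_ : L.Structure M) (_ : Nonempty M) (a : α → M), ∀ φ ∈ s, φ.Realize a) :
    ∃ (N : Type (max u v)) (_ : L.Structure N) (_ : Nonempty N) (_ : Countable N) (a : α → N),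
      ∀ φ ∈ S, φ.Realize a := by
  classical
  have hsat : Theory.IsSatisfiable (L := L[[α]]) (Formula.equivSentence '' S) := by
    rw [Theory.isSatisfiable_iff_isFinitelySatisfiable]
    intro T₀ hT₀
    obtain ⟨M, _, _, a, ha⟩ := h (T₀.image Formula.equivSentence.symm) (by
      intro φ hφ
      obtain ⟨ψ, hψ, rfl⟩ := Finset.mem_image.1 (Finset.mem_coe.1 hφ)
      obtain ⟨χ, hχ, rfl⟩ := hT₀ hψ
      simpa using hχ)
    let _ := constantsOn.structure a
    have : M ⊨ (T₀ : L[[α]].Theory) := by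
      refine ⟨fun ψ hψ => ?_⟩
      exact (Formula.realize_equivSentence_symm M ψ a).1 (ha _ (Finset.mem_image_of_mem _ hψ))
    exact Theory.Model.isSatisfiable M
  obtain ⟨N, _, hne, hc, hN⟩ := exists_countable_model.{u, v} (L := L[[α]]) hsat
  let _ := (L.lhomWithConstants α).reduct N
  refine ⟨N, inferInstance, hne, hc, fun i => (L.con i : N), fun φ hφ => ?_⟩
  exact (Formula.realize_equivSentence N φ).1
    (hN.realize_of_mem _ (Set.mem_image_of_mem _ hφ))

end Compactness

/-! ### Saturation of ultrapowers over `ℕ` -/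

section Ultrapower

variable {L : FirstOrder.Language.{u, v}} {M : Type w} [L.Structure M]

/-- The ultrapower of `M` over a nonprincipal ultrafilter on `ℕ`. -/
abbrev Ultrapower (M : Type w) : Type w :=
  (hyperfilter ℕ : Filter ℕ).Product fun _ => M

/-- The element of the ultrapower represented by a sequence. -/
noncomputable abbrev toUltrapower (x : ℕ → M) : Ultrapower M :=
  Quotient.mk ((hyperfilter ℕ : Filter ℕ).productSetoid fun _ => M) x

theorem realize_toUltrapower [Nonempty M] {β : Type*} (φ : L.Formula β) (x : β → ℕ → M) :
    (φ.Realize fun i => toUltrapower (x i)) ↔ ∀ᶠ t in hyperfilter ℕ, φ.Realize fun i => x i t :=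
  Ultraproduct.realize_formula_cast φ x

/-- The ultrapower realizes a countable set of formulas, in parameters `v` and arbitrarily many
unknowns, as soon as each finite subset of it is solvable at almost all coordinates. -/
theorem exists_realize_ultrapower [Nonempty M] {α β : Type*} (v : α → ℕ → M)
    (g : ℕ → L.Formula (α ⊕ β))
    (h : ∀ m, ∀ᶠ t in hyperfilter ℕ, ∃ z : β → M, ∀ j < m,
      (g j).Realize (Sum.elim (fun i => v i t) z)) :
    ∃ f : β → ℕ → M, ∀ j,
      (g j).Realize (Sum.elim (fun i => toUltrapower (v i)) fun n => toUltrapower (f n)) := by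
  classical
  -- at coordinate `t`, solve the longest solvable initial segment of length at most `t`
  have hz : ∀ t, ∃ z : β → M, ∀ m ≤ t,
      (∃ z : β → M, ∀ j < m, (g j).Realize (Sum.elim (fun i => v i t) z)) →
        ∀ j < m, (g j).Realize (Sum.elim (fun i => v i t) z) := by
    intro t
    let P : ℕ → Prop := fun m => ∃ z : β → M, ∀ j < m, (g j).Realize (Sum.elim (fun i => v i t) z)
    have h0 : P 0 := ⟨fun _ => Classical.arbitrary M, fun j hj => absurd hj (Nat.not_lt_zero j)⟩
    obtain ⟨z, hz⟩ := Nat.findGreatest_spec (P := P) (Nat.zero_le t) h0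
    exact ⟨z, fun m hm hP j hj => hz j (hj.trans_le (Nat.le_findGreatest hm hP))⟩
  choose z hz using hz
  refine ⟨fun n t => z t n, fun j => ?_⟩
  have key := (realize_toUltrapower (g j) (Sum.elim v fun n t => z t n)).2 (by
    have hlarge : ∀ᶠ t in hyperfilter ℕ, j + 1 ≤ t :=
      hyperfilter_le_cofinite (Nat.cofinite_eq_atTop ▸ eventually_ge_atTop (j + 1))
    filter_upwards [h (j + 1), hlarge] with t ht hjt
    convert hz t (j + 1) hjt ht j j.lt_succ_self using 1
    ext (i | i) <;> rfl)
  convert key using 1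
  ext (i | i) <;> rfl

/-- A countable structure `N` embeds into the ultrapower over a tuple `v` if every existential
formula true of the corresponding tuple `c` of `N` is true of `v`. -/
theorem exists_embedding_ultrapower [Countable L.Symbols] [Nonempty M] {α : Type} [Countable α]
    {N : Type w'} [L.Structure N] [Nonempty N] [Countable N] (c : α → N) (v : α → ℕ → M)
    (h : ∀ σ : L.Formula (α ⊕ ℕ), σ.IsQF → (∃ z : ℕ → N, σ.Realize (Sum.elim c z)) →
      ∃ z : ℕ → Ultrapower M, σ.Realize (Sum.elim (fun i => toUltrapower (v i)) z)) :
    ∃ f : N ↪[L] Ultrapower M, ∀ i, f (c i) = toUltrapower (v i) := by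
  -- the quantifier-free diagram of `N`, with the parameters named a second time by `α`
  let D : Set (L.Formula (α ⊕ N)) := {θ | θ.IsQF ∧ θ.Realize (Sum.elim c id)}
  have hD : ∀ θ ∈ D, ∀ᶠ t in hyperfilter ℕ, ∃ z : N → M,
      θ.Realize (Sum.elim (fun i => v i t) z) := by
    rintro θ ⟨hqf, hθ⟩
    obtain ⟨e, he⟩ := Countable.exists_injective_nat N
    obtain ⟨z, hz⟩ := h (θ.relabel (Sum.map id e)) (hqf.relabel _)
      ⟨Function.invFun e, by
        rwa [Formula.realize_relabel, Sum.elim_comp_map, Function.comp_id,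
          Function.invFun_comp he]⟩
    rw [Formula.realize_relabel, Sum.elim_comp_map, Function.comp_id] at hz
    choose y hy using fun n => Quotient.exists_rep (z n)
    have key := (realize_toUltrapower θ (Sum.elim v fun n => y (e n))).1 (by
      convert hz using 1
      ext (i | i)
      · rfl
      · exact hy (e i))
    filter_upwards [key] with t ht
    refine ⟨fun n => y (e n) t, ?_⟩
    convert ht using 1
    ext (i | i) <;> rfl
  have htop : (⊤ : L.Formula (α ⊕ N)) ∈ D := ⟨IsQF.top, Formula.realize_top.2 trivial⟩
  have : Nonempty D := ⟨⟨_, htop⟩⟩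
  have : Countable D := by
    infer_instance
  obtain ⟨g, hg⟩ := exists_surjective_nat D
  obtain ⟨f, hf⟩ := exists_realize_ultrapower v (fun j => (g j : L.Formula (α ⊕ N))) (by
    intro m
    have : ∃ θ ∈ D, ∀ x : α ⊕ N → M, θ.Realize x →
        ∀ j < m, (g j : L.Formula (α ⊕ N)).Realize x := by
      induction m with
      | zero => exact ⟨_, htop, fun _ _ j hj => absurd hj (Nat.not_lt_zero j)⟩
      | succ m ih =>
        obtain ⟨θ, hθ, hx⟩ := ih
        refine ⟨θ ⊓ g m, ⟨hθ.1.inf (g m).2.1, Formula.realize_inf.2 ⟨hθ.2, (g m).2.2⟩⟩,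
          fun x h j hj => ?_⟩
        rw [Formula.realize_inf] at h
        rcases Nat.lt_succ_iff_lt_or_eq.1 hj with hj | rfl
        · exact hx x h.1 j hj
        · exact h.2
    obtain ⟨θ, hθ, hx⟩ := this
    filter_upwards [hD θ hθ] with t ⟨z, hz⟩
    exact ⟨z, hx _ hz⟩)
  have hf : ∀ θ : L.Formula (α ⊕ N), θ.IsQF → θ.Realize (Sum.elim c id) →
      θ.Realize (Sum.elim (fun i => toUltrapower (v i)) fun n => toUltrapower (f n)) := by
    intro θ h₁ h₂
    obtain ⟨j, hj⟩ := hg ⟨θ, h₁, h₂⟩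
    have := hf j
    rwa [hj] at this
  refine ⟨⟨⟨fun n => toUltrapower (f n), ?_⟩, ?_, ?_⟩, ?_⟩
  · intro x y hxy
    by_contra hne
    have := hf (Term.equal (Term.var (Sum.inr x)) (Term.var (Sum.inr y))).not
      (IsAtomic.equal _ _).isQF.not (by simpa [Formula.realize_not, Formula.realize_equal] using hne)
    rw [Formula.realize_not, Formula.realize_equal] at this
    exact this hxy
  · intro m F x
    have := hf (Term.equal (Term.var (Sum.inr (Structure.funMap F x)))
      (Term.func F fun i => Term.var (Sum.inr (x i)))) (IsAtomic.equal _ _).isQF (by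
        simp [Formula.realize_equal])
    simpa [Formula.realize_equal, Function.comp_def] using this
  · intro m R x
    let ρ : L.Formula (α ⊕ N) := R.formula fun i => Term.var (Sum.inr (x i))
    have hρ : ρ.IsQF := (IsAtomic.rel _ _).isQF
    constructor
    · intro h'
      by_contra hne
      have := hf ρ.not hρ.not (by
        simpa [ρ, Formula.realize_not, Formula.realize_rel] using hne)
      simp only [ρ, Formula.realize_not, Formula.realize_rel, Term.realize_var,
        Sum.elim_inr] at this
      exact this h'
    · intro h'
      have := hf ρ hρ (by simpa [ρ, Formula.realize_rel] using h')
      simpa [ρ, Formula.realize_rel, Function.comp_def] using this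
  · intro i
    have := hf (Term.equal (Term.var (Sum.inr (c i))) (Term.var (Sum.inl i)))
      (IsAtomic.equal _ _).isQF (by simp [Formula.realize_equal])
    rw [Formula.realize_equal] at this
    exact this

end Ultrapower

/-! ### Structures with named parameters -/

section Expansion

variable {L : FirstOrder.Language.{u, v}} {n : ℕ}

variable (L) in
/-- The expansion of `M` in which the constant `cᵢ` names `a i`. -/
def expand (M : Type w) [L.Structure M] (a : Fin n → M) :
    CategoryTheory.Bundled.{w} L[[Fin n]].Structure :=
  letI := constantsOn.structure a
  ⟨M, inferInstance⟩

theorem expand_mem_modelClass {T : Set (L.Formula (Fin n))} {M : Type w} [L.Structure M]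
    [Nonempty M] {a : Fin n → M} :
    expand L M a ∈ modelClass (closeTheory T) ↔ ∀ φ ∈ T, φ.Realize a := by
  let _ := constantsOn.structure a
  have key : M ⊨ closeTheory T ↔ ∀ φ ∈ T, φ.Realize a := by
    rw [closeTheory, Theory.model_iff, Set.forall_mem_image]
    exact forall₂_congr fun φ _ => Formula.realize_equivSentence M φ
  exact ⟨fun h => key.1 h.2, fun h => ⟨‹_›, key.2 h⟩⟩

theorem mem_modelClass_iff {T : Set (L.Formula (Fin n))}
    {M : CategoryTheory.Bundled.{w} L[[Fin n]].Structure} :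
    letI := (L.lhomWithConstants (Fin n)).reduct M
    M ∈ modelClass (closeTheory T) ↔
      Nonempty M ∧ ∀ φ ∈ T, φ.Realize fun i => ((L.con i : L[[Fin n]].Constants) : M) := by
  let _ := (L.lhomWithConstants (Fin n)).reduct M
  refine and_congr_right fun _ => ?_
  rw [closeTheory, Theory.model_iff, Set.forall_mem_image]
  exact forall₂_congr fun φ _ => Formula.realize_equivSentence M φ

/-- The image of a model under an embedding matching the parameters is a submodel. -/
theorem exists_substructure_expand {T : Set (L.Formula (Fin n))} {N : Type w'} [L.Structure N]
    [Nonempty N] {M : Type w} [L.Structure M] (f : N ↪[L] M) {c : Fin n → N} {a : Fin n → M}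
    (hc : ∀ i, f (c i) = a i) (hN : ∀ φ ∈ T, φ.Realize c) :
    ∃ S : L[[Fin n]].Substructure (expand L M a), Nonempty S ∧
      CategoryTheory.Bundled.of (c := L[[Fin n]].Structure) S ∈ modelClass (closeTheory T) ∧
      S.carrier = Set.range f := by
  let f' : (expand L N c) ↪[L[[Fin n]]] (expand L M a) :=
    { toFun := f
      inj' := f.injective
      map_fun' := by
        rintro m (F | F) x
        · exact (f.map_fun F x : _)
        · match m, F with
          | 0, F => exact hc F
      map_rel' := by
        rintro m (R | R) x
        · exact f.map_rel R x
        · exact R.elim }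
  have hmod := (expand_mem_modelClass (T := T)).2 hN
  have h₁ : (expand L N c) ⊨ closeTheory T := hmod.2
  have h₂ : f'.toHom.range ⊨ closeTheory T := StrongHomClass.theory_model f'.equivRange
  have h₃ : Nonempty f'.toHom.range := f'.equivRange.toEquiv.nonempty_congr.1 hmod.1
  exact ⟨f'.toHom.range, h₃, ⟨h₃, h₂⟩, Hom.range_coe _⟩

end Expansion

/-! ### Covers of ultrapowers by models -/

section Cover

variable {L : FirstOrder.Language.{u, v}} {n : ℕ}

/-- The `∀ᵏ∃*` consequences of `T`. -/
def consequences (k : ℕ) (T : Set (L.Formula (Fin n))) : Set (L.Formula (Fin n)) :=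
  {φ | IsForallExists k φ ∧ ∀ (M : Type w) [L.Structure M] [Nonempty M] (a : Fin n → M),
    (∀ ψ ∈ T, ψ.Realize a) → φ.Realize a}

/-- If the `∀ᵏ∃*` consequences of `T` hold in `(M, a)` then, over each `k`-tuple `b`, there is a
countable model of `T` all of whose existential facts about the parameters hold in `(M, a, b)`. -/
theorem exists_countable_model_of_consequences [Countable L.Symbols]
    {T : Set (L.Formula (Fin n))} {k : ℕ} {M : Type w'} [L.Structure M] [Nonempty M]
    {a : Fin n → M} (hM : ∀ φ ∈ consequences.{u, v, w} k T, φ.Realize a) (b : Fin k → M) :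
    ∃ (N : Type (max u v)) (_ : L.Structure N) (_ : Nonempty N) (_ : Countable N)
      (c : Fin n ⊕ Fin k → N), (∀ φ ∈ T, φ.Realize (c ∘ Sum.inl)) ∧
        ∀ σ : L.Formula ((Fin n ⊕ Fin k) ⊕ ℕ), σ.IsQF →
          (∃ z : ℕ → N, σ.Realize (Sum.elim c z)) →
            ∃ z : ℕ → M, σ.Realize (Sum.elim (Sum.elim a b) z) := by
  classical
  let E : Set (L.Formula (Fin n ⊕ Fin k)) :=
    {φ | ∃ σ : L.Formula ((Fin n ⊕ Fin k) ⊕ ℕ), σ.IsQF ∧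
      (¬ ∃ z : ℕ → M, σ.Realize (Sum.elim (Sum.elim a b) z)) ∧ φ = (existsNat σ).not}
  have hfin : ∀ s : Finset (L.Formula (Fin n ⊕ Fin k)),
      (s : Set (L.Formula (Fin n ⊕ Fin k))) ⊆ Formula.relabel Sum.inl '' T ∪ E →
      ∃ (M : Type w) (_ : L.Structure M) (_ : Nonempty M) (c : Fin n ⊕ Fin k → M),
        ∀ φ ∈ s, φ.Realize c := by
    intro s hs
    -- a single existential formula, false of `(a, b)`, whose negation accounts for all of `s ∩ E`
    have hσ : ∃ σ : L.Formula ((Fin n ⊕ Fin k) ⊕ ℕ), σ.IsQF ∧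
        (¬ ∃ z : ℕ → M, σ.Realize (Sum.elim (Sum.elim a b) z)) ∧
        ∀ (M' : Type w) [L.Structure M'] [Nonempty M'] (c : Fin n ⊕ Fin k → M'),
          (∀ φ ∈ T, φ.Realize (c ∘ Sum.inl)) →
          (¬ ∃ z : ℕ → M', σ.Realize (Sum.elim c z)) → ∀ φ ∈ s, φ.Realize c := by
      induction s using Finset.induction_on with
      | empty => exact ⟨⊥, isQF_bot, fun ⟨_, h⟩ => h, fun _ _ _ _ _ _ φ hφ => by simp at hφ⟩
      | insert ψ s _ ih =>
        rw [Finset.coe_insert, Set.insert_subset_iff] at hs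
        obtain ⟨σ, hqf, hσ, h⟩ := ih hs.2
        rcases hs.1 with ⟨χ, hχ, rfl⟩ | ⟨τ, hτqf, hτ, rfl⟩
        · refine ⟨σ, hqf, hσ, fun M' _ _ c hc hσ' φ hφ => ?_⟩
          rcases Finset.mem_insert.1 hφ with rfl | hφ
          · exact Formula.realize_relabel.2 (hc _ hχ)
          · exact h M' c hc hσ' φ hφ
        · refine ⟨σ ⊔ τ, hqf.sup hτqf, ?_, fun M' _ _ c hc hσ' φ hφ => ?_⟩
          · rintro ⟨z, hz⟩
            rcases Formula.realize_sup.1 hz with hz | hz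
            exacts [hσ ⟨z, hz⟩, hτ ⟨z, hz⟩]
          · rcases Finset.mem_insert.1 hφ with rfl | hφ
            · rw [Formula.realize_not, realize_existsNat]
              exact fun ⟨z, hz⟩ => hσ' ⟨z, Formula.realize_sup.2 (Or.inr hz)⟩
            · exact h M' c hc
                (fun ⟨z, hz⟩ => hσ' ⟨z, Formula.realize_sup.2 (Or.inl hz)⟩) φ hφ
    obtain ⟨σ, hqf, hσ, h⟩ := hσ
    have hnot : ¬ (forallBlock (existsNat σ)).Realize a := fun h' =>
      hσ (realize_existsNat.1 (realize_forallBlock.1 h' b))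
    have hmem : forallBlock (existsNat σ) ∉ consequences.{u, v, w} k T := fun h' => hnot (hM _ h')
    have hmem' : ¬ ∀ (M : Type w) [L.Structure M] [Nonempty M] (a : Fin n → M),
        (∀ ψ ∈ T, ψ.Realize a) → (forallBlock (existsNat σ)).Realize a := fun h' =>
      hmem ⟨isForallExists_forallBlock (isExistential_existsNat hqf), h'⟩
    push Not at hmem'
    obtain ⟨M', _, _, a', ha', hφ⟩ := hmem'
    rw [realize_forallBlock] at hφ
    push Not at hφ
    obtain ⟨b', hb'⟩ := hφ
    rw [realize_existsNat] at hb'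
    exact ⟨M', inferInstance, inferInstance, Sum.elim a' b',
      h M' _ (by rwa [Sum.elim_comp_inl]) hb'⟩
  obtain ⟨N, _, _, _, c, hc⟩ := exists_countable_realize.{u, v, w} hfin
  refine ⟨N, inferInstance, inferInstance, inferInstance, c, fun φ hφ => ?_, fun σ hqf hz => ?_⟩
  · exact Formula.realize_relabel.1 (hc _ (Or.inl (Set.mem_image_of_mem _ hφ)))
  · by_contra hne
    have := hc _ (Or.inr ⟨σ, hqf, hne, rfl⟩)
    rw [Formula.realize_not, realize_existsNat] at this
    exact this hz

theorem realize_const_toUltrapower {M : Type w} [L.Structure M] [Nonempty M]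
    {φ : L.Formula (Fin n)} {a : Fin n → M} :
    (φ.Realize fun i => toUltrapower fun _ => a i) ↔ φ.Realize a := by
  rw [realize_toUltrapower, eventually_const]

variable (L) in
/-- The ultrapower of `M`, expanded by constants for the diagonal images of the tuple `a`. -/
noncomputable def expandUltrapower (M : Type w) [L.Structure M] (a : Fin n → M) :
    CategoryTheory.Bundled.{w} L[[Fin n]].Structure :=
  expand L (Ultrapower M) fun i => toUltrapower fun _ => a i

theorem expandUltrapower_mem_modelClass {T : Set (L.Formula (Fin n))} {M : Type w} [L.Structure M]
    [Nonempty M] {a : Fin n → M} :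
    expandUltrapower L M a ∈ modelClass (closeTheory T) ↔ ∀ φ ∈ T, φ.Realize a :=
  expand_mem_modelClass.trans (forall₂_congr fun _ _ => realize_const_toUltrapower)

instance nonempty_expandUltrapower {M : Type w} [L.Structure M] [Nonempty M] {a : Fin n → M} :
    Nonempty (expandUltrapower L M a) :=
  inferInstanceAs (Nonempty (Ultrapower M))

/-- If the `∀ᵏ∃*` consequences of `T` hold in `(M, a)`, every `k`-tuple of the ultrapower of `M`
lies in a substructure that is a model of `T`. -/
theorem exists_submodel_ultrapower [Countable L.Symbols]
    {T : Set (L.Formula (Fin n))} {k : ℕ} {M : Type w'} [L.Structure M] [Nonempty M]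
    {a : Fin n → M} (hM : ∀ φ ∈ consequences.{u, v, w} k T, φ.Realize a)
    (b : Fin k → expandUltrapower L M a) :
    ∃ S : L[[Fin n]].Substructure (expandUltrapower L M a), Nonempty S ∧
      CategoryTheory.Bundled.of (c := L[[Fin n]].Structure) S ∈ modelClass (closeTheory T) ∧
      Set.range b ⊆ S := by
  obtain ⟨N, _, _, _, c, hT, hE⟩ := exists_countable_model_of_consequences
    (M := Ultrapower M) (fun φ hφ => realize_const_toUltrapower.2 (hM φ hφ)) b
  choose y hy using fun i => Quotient.exists_rep (b i : Ultrapower M)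
  have hv : (fun i => toUltrapower (Sum.elim (fun i _ => a i) y i)) =
      Sum.elim (fun i => toUltrapower fun _ => a i) b := by
    ext (i | i)
    · rfl
    · exact hy i
  obtain ⟨f, hf⟩ := exists_embedding_ultrapower c (Sum.elim (fun i _ => a i) y)
    (by rwa [hv])
  obtain ⟨S, h₁, h₂, h₃⟩ := exists_substructure_expand f
    (a := fun i => toUltrapower fun _ => a i) (fun i => hf (Sum.inl i)) hT
  refine ⟨S, h₁, h₂, ?_⟩
  rintro _ ⟨i, rfl⟩
  exact h₃.ge ⟨c (Sum.inr i), (hf (Sum.inr i)).trans (hy i)⟩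

theorem exists_subset_range_fin {X : Type*} [Nonempty X] {k : ℕ} {A : Finset X}
    (h : A.card ≤ k) : ∃ b : Fin k → X, (A : Set X) ⊆ Set.range b := by
  refine ⟨fun i => if hi : i.1 < A.card then A.equivFin.symm ⟨i, hi⟩ else Classical.arbitrary X,
    fun x hx => ?_⟩
  let j := A.equivFin ⟨x, hx⟩
  exact ⟨⟨j, j.2.trans_le h⟩, by simp [j]⟩

theorem realize_of_memPCE [Countable L.Symbols] {T : Set (L.Formula (Fin n))} {k : ℕ}
    (hT : MemPCE.{u, v, w'} k T) {M : Type w'} [L.Structure M] [Nonempty M] {a : Fin n → M}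
    (hM : ∀ φ ∈ consequences.{u, v, w} k T, φ.Realize a) : ∀ φ ∈ T, φ.Realize a := by
  have covers : ∀ A : Finset (expandUltrapower L M a), A.card ≤ k →
      ∃ S ∈ {S : L[[Fin n]].Substructure (expandUltrapower L M a) | Nonempty S ∧
        CategoryTheory.Bundled.of (c := L[[Fin n]].Structure) S ∈ modelClass (closeTheory T)},
        (A : Set (expandUltrapower L M a)) ⊆ S := by
    intro A hA
    obtain ⟨b, hb⟩ := exists_subset_range_fin hA
    obtain ⟨S, h₁, h₂, h₃⟩ := exists_submodel_ultrapower hM b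
    exact ⟨S, ⟨h₁, h₂⟩, hb.trans h₃⟩
  obtain ⟨S, hS, -⟩ := covers ∅ (Nat.zero_le k)
  exact expandUltrapower_mem_modelClass.1
    (hT _ _ (fun S hS => hS.2) ⟨⟨S, hS⟩, fun S hS => hS.1, covers⟩)

theorem realize_of_memPCEf [Countable L.Symbols] {T : Set (L.Formula (Fin n))}
    (hT : MemPCEf.{u, v, w'} T) {M : Type w'} [L.Structure M] [Nonempty M] {a : Fin n → M}
    (hM : ∀ k, ∀ φ ∈ consequences.{u, v, w} k T, φ.Realize a) : ∀ φ ∈ T, φ.Realize a := by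
  refine expandUltrapower_mem_modelClass.1 (hT (expandUltrapower L M a)
    {S | Nonempty S ∧
      CategoryTheory.Bundled.of (c := L[[Fin n]].Structure) S ∈ modelClass (closeTheory T)}
    (fun S hS => hS.2) ⟨fun S hS => hS.1, fun A => ?_⟩)
  obtain ⟨b, hb⟩ := exists_subset_range_fin (le_refl A.card)
  obtain ⟨S, h₁, h₂, h₃⟩ := exists_submodel_ultrapower (hM A.card) b
  exact ⟨S, ⟨h₁, h₂⟩, hb.trans h₃⟩

end Cover

/-! ### Preservation under covered extensions -/

section Preservation

variable {L : FirstOrder.Language.{u, v}}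

/-- A `∀ᵏ∃*` formula holds in `M` once any `k` elements of `M`, together with the assigned values,
lie in an embedded structure in which it holds. -/
theorem IsForallExists.realize_of_covers {α : Type} {M : Type w} [L.Structure M] {k m : ℕ}
    {φ : L.BoundedFormula α m} (h : IsForallExists k φ) (v : α → M) (xs : Fin m → M)
    (H : ∀ A : Finset M, A.card ≤ k → ∃ (N : Type w') (_ : L.Structure N) (f : N ↪[L] M)
      (v' : α → N) (xs' : Fin m → N), f ∘ v' = v ∧ f ∘ xs' = xs ∧ (A : Set M) ⊆ Set.range f ∧
        φ.Realize v' xs') :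
    φ.Realize v xs := by
  classical
  induction h with
  | of_isExistential h =>
    obtain ⟨N, _, f, v', xs', rfl, rfl, -, hφ⟩ := H ∅ le_rfl
    exact h.realize_embedding f hφ
  | all _ ih =>
    rw [realize_all]
    refine fun x => ih _ fun A hA => ?_
    obtain ⟨N, _, f, v', xs', hv, hxs, hsub, hφ⟩ :=
      H (insert x A) ((Finset.card_insert_le x A).trans (Nat.succ_le_succ hA))
    obtain ⟨x', hx'⟩ := hsub (Finset.mem_insert_self x A)
    refine ⟨N, inferInstance, f, v', Fin.snoc xs' x', hv, ?_,
      fun y hy => hsub (Finset.mem_insert_of_mem hy), hφ x'⟩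
    rw [Fin.comp_snoc, hxs, hx']

variable {n : ℕ}

/-- A `∀ᵏ∃*` formula passes from the members of a collection of substructures to the whole
structure if every set of at most `k` elements lies in a member of the collection. -/
theorem IsForallExists.realize_of_substructures {k : ℕ} {φ : L.Formula (Fin n)}
    (h : IsForallExists k φ) {M : Type w} [L[[Fin n]].Structure M]
    (H : ∀ A : Finset M, A.card ≤ k → ∃ N : L[[Fin n]].Substructure M, (A : Set M) ⊆ N ∧
      letI := (L.lhomWithConstants (Fin n)).reduct N
      φ.Realize fun i => ((L.con i : L[[Fin n]].Constants) : N)) :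
    letI := (L.lhomWithConstants (Fin n)).reduct M
    φ.Realize fun i => ((L.con i : L[[Fin n]].Constants) : M) := by
  let _ := (L.lhomWithConstants (Fin n)).reduct M
  refine h.realize_of_covers _ _ fun A hA => ?_
  obtain ⟨N, hN, hφ⟩ := H A hA
  let _ := (L.lhomWithConstants (Fin n)).reduct N
  let f : N ↪[L] M :=
    { toFun := fun x => x
      inj' := Subtype.val_injective
      map_fun' := fun F x => N.subtype.map_fun ((L.lhomWithConstants (Fin n)).onFunction F) x
      map_rel' := fun R x => N.subtype.map_rel ((L.lhomWithConstants (Fin n)).onRelation R) x }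
  refine ⟨N, inferInstance, f, fun i => ((L.con i : L[[Fin n]].Constants) : N), default, ?_,
    Subsingleton.elim _ _, fun x hx => ⟨⟨x, hN hx⟩, rfl⟩, hφ⟩
  funext i
  exact N.subtype.map_constants (L.con i)

/-- A structure covered by models of `T` satisfies each `∀ᵏ∃*` formula that follows from `T`. -/
theorem realize_of_models {k : ℕ} {T : Set (L.Formula (Fin n))} {φ : L.Formula (Fin n)}
    (hφ : φ ∈ consequences.{u, v, w} k T) {M : Type w} [L[[Fin n]].Structure M]
    (H : ∀ A : Finset M, A.card ≤ k → ∃ N : L[[Fin n]].Substructure M, (A : Set M) ⊆ N ∧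
      CategoryTheory.Bundled.of (c := L[[Fin n]].Structure) N ∈ modelClass (closeTheory T)) :
    letI := (L.lhomWithConstants (Fin n)).reduct M
    φ.Realize fun i => ((L.con i : L[[Fin n]].Constants) : M) := by
  refine hφ.1.realize_of_substructures fun A hA => ?_
  obtain ⟨N, hAN, hN⟩ := H A hA
  let _ := (L.lhomWithConstants (Fin n)).reduct N
  obtain ⟨hne, hT⟩ := mem_modelClass_iff.1 hN
  have : Nonempty N := hne
  exact ⟨N, hAN, hφ.2 N _ hT⟩

theorem mem_consequences_of_theoryEquiv {k : ℕ} {T Γ : Set (L.Formula (Fin n))}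
    (h : TheoryEquiv.{u, v, w} T Γ) {φ : L.Formula (Fin n)} (hφ : φ ∈ Γ)
    (hk : IsForallExists k φ) : φ ∈ consequences.{u, v, w} k T :=
  ⟨hk, fun M _ _ a ha => (h M a).1 ha φ hφ⟩

theorem memPCE_of_theoryEquiv {k : ℕ} {T Γ : Set (L.Formula (Fin n))}
    (hΓ : ∀ φ ∈ Γ, IsForallExists k φ) (h : TheoryEquiv.{u, v, w} T Γ) : MemPCE.{u, v, w} k T := by
  intro M R hR hcov
  obtain ⟨N, hN⟩ := hcov.nonempty
  have : Nonempty M := (hcov.nonempty_of_mem N hN).map Subtype.val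
  refine mem_modelClass_iff.2 ⟨this, ?_⟩
  let _ := (L.lhomWithConstants (Fin n)).reduct M
  refine (h M _).2 fun φ hφ =>
    realize_of_models (mem_consequences_of_theoryEquiv h hφ (hΓ φ hφ)) fun A hA => ?_
  obtain ⟨N, hN, hAN⟩ := hcov.covers A hA
  exact ⟨N, hAN, hR N hN⟩

theorem memPCEf_of_theoryEquiv {T Γ : Set (L.Formula (Fin n))}
    (hΓ : ∀ φ ∈ Γ, IsPiTwo φ) (h : TheoryEquiv.{u, v, w} T Γ) : MemPCEf.{u, v, w} T := by
  intro M R hR hcov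
  obtain ⟨N, hN, -⟩ := hcov.covers ∅
  have : Nonempty M := (hcov.nonempty_of_mem N hN).map Subtype.val
  refine mem_modelClass_iff.2 ⟨this, ?_⟩
  let _ := (L.lhomWithConstants (Fin n)).reduct M
  refine (h M _).2 fun φ hφ => ?_
  obtain ⟨k, hk⟩ := hΓ φ hφ
  refine realize_of_models (mem_consequences_of_theoryEquiv h hφ hk) fun A _ => ?_
  obtain ⟨N, hN, hAN⟩ := hcov.covers A
  exact ⟨N, hAN, hR N hN⟩

end Preservation

/-! ### The characterizations -/

section Characterization

variable {L : FirstOrder.Language.{u, v}} {n : ℕ}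

theorem memPCE_iff [Countable L.Symbols] {T : Set (L.Formula (Fin n))} {k : ℕ} :
    MemPCE.{u, v, w} k T ↔ ∃ Γ : Set (L.Formula (Fin n)),
      (∀ φ ∈ Γ, IsForallExists k φ) ∧ TheoryEquiv.{u, v, w} T Γ :=
  ⟨fun h => ⟨consequences.{u, v, w} k T, fun _ hφ => hφ.1, fun M _ _ a =>
    ⟨fun ha _ hφ => hφ.2 M a ha, realize_of_memPCE h⟩⟩,
    fun ⟨_, hΓ, h⟩ => memPCE_of_theoryEquiv hΓ h⟩

theorem memPCEf_iff [Countable L.Symbols] {T : Set (L.Formula (Fin n))} :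
    MemPCEf.{u, v, w} T ↔ ∃ Γ : Set (L.Formula (Fin n)),
      (∀ φ ∈ Γ, IsPiTwo φ) ∧ TheoryEquiv.{u, v, w} T Γ := by
  refine ⟨fun h => ⟨⋃ k, consequences.{u, v, w} k T, fun φ hφ => ?_, fun M _ _ a =>
    ⟨fun ha φ hφ => ?_, fun ha => ?_⟩⟩, fun ⟨_, hΓ, h⟩ => memPCEf_of_theoryEquiv hΓ h⟩
  · obtain ⟨k, hk⟩ := Set.mem_iUnion.1 hφ
    exact ⟨k, hk.1⟩
  · obtain ⟨k, hk⟩ := Set.mem_iUnion.1 hφ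
    exact hk.2 M a ha
  · exact realize_of_memPCEf h fun k φ hφ => ha φ (Set.mem_iUnion_of_mem k hφ)

/-- A `0`-ary cover is an arbitrary nonempty collection, so one member of it suffices. -/
theorem memPE_iff_memPCE_zero {T : Set (L.Formula (Fin n))} :
    MemPE.{u, v, w} T ↔ MemPCE.{u, v, w} 0 T := by
  constructor
  · intro h M R hR hcov
    obtain ⟨N, hN⟩ := hcov.nonempty
    exact h M N (hcov.nonempty_of_mem N hN) (hR N hN)
  · intro h M N hne hN
    refine h M {N} (fun N' hN' => ?_) ⟨⟨N, rfl⟩, fun N' hN' => ?_, fun A hA => ⟨N, rfl, ?_⟩⟩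
    · obtain rfl := Set.mem_singleton_iff.1 hN'
      exact hN
    · obtain rfl := Set.mem_singleton_iff.1 hN'
      exact hne
    · rw [Finset.card_eq_zero.1 (Nat.le_zero.1 hA)]
      simp

end Characterization

end CoveredExtensions

theorem theorem6 {L : FirstOrder.Language.{u, v}} [Finite L.Symbols] {n : ℕ}
    (T : Set (L.Formula (Fin n))) :
    (CoveredExtensions.MemPCEf.{u, v, max u v w} T ↔
      ∃ Γ : Set (L.Formula (Fin n)),
        (∀ φ ∈ Γ, CoveredExtensions.IsPiTwo φ) ∧
          CoveredExtensions.TheoryEquiv.{u, v, max u v w} T Γ) ∧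
    (∀ k : ℕ, CoveredExtensions.MemPCE.{u, v, max u v w} k T ↔
      ∃ Γ : Set (L.Formula (Fin n)),
        (∀ φ ∈ Γ, CoveredExtensions.IsForallExists k φ) ∧
          CoveredExtensions.TheoryEquiv.{u, v, max u v w} T Γ) ∧
    (CoveredExtensions.MemPE.{u, v, max u v w} T ↔
      ∃ Γ : Set (L.Formula (Fin n)),
        (∀ φ ∈ Γ, φ.IsExistential) ∧
          CoveredExtensions.TheoryEquiv.{u, v, max u v w} T Γ) := by
  refine ⟨CoveredExtensions.memPCEf_iff, fun k => CoveredExtensions.memPCE_iff, ?_⟩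
  rw [CoveredExtensions.memPE_iff_memPCE_zero, CoveredExtensions.memPCE_iff]
  simp only [CoveredExtensions.isForallExists_zero_iff]
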